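/- Let $t=t_0t_1t_2\cdots=\lim_{q\to\infty}m^q(0)$ be the Thue–Morse word, where $m$ is the morphism $0\mapsto 01$, $1\mapsto 10$, and let $T_n$ be the set of factors of $t$ of length $n$. Two words $u,v$ are 2-abelian equivalent, $u\equiv_2 v$, if they have the same prefix of length $1$ and the same suffix of length $1$ (when non-empty), and every word $w$ of length $2$ occurs equally often in $u$ and in $v$. Let $P_n=\#(T_n/{\equiv_2})$ for $n\ge 0$. The 2-kernel of an integer sequence $(a_n)_{n\ge 0}$ is the set of subsequences $(a_{2^e n+c})_{n\ge 0}$ with $e\ge 0$, $0\le c<2^e$; the sequence is 2-regular if the $\mathbb{Z}$-module generated by its 2-kernel is finitely generated. (1) The sequence $(P_n)_{n\ge 0}$ is 2-regular. (2) For all $n\ge 0$ the following 13 relations hold: \begin{enumerate} \item $P_{4n+1}=P_{2n+1}$ \item $P_{8n+4}=P_{8n+3}+P_{4n+3}-P_{4n+2}$ \item $P_{16n}=P_{8n}$ \item $P_{16n+2}=P_{8n+2}$ \item $P_{16n+6}=-P_{16n+3}+P_{8n+3}+3P_{8n+2}+P_{4n+3}-2P_{4n+2}-P_{2n+1}$ \item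 $P_{16n+7}=-P_{16n+3}+P_{8n+3}+3P_{8n+2}+2P_{4n+3}-3P_{4n+2}-P_{2n+1}$ \item $P_{16n+8}=P_{8n+2}+P_{4n+3}-P_{2n+1}$ \item $P_{16n+10}=P_{8n+2}+P_{4n+3}-P_{2n+1}$ \item $P_{16n+11}=-P_{16n+3}+3P_{8n+2}+P_{4n+3}-2P_{2n+1}$ \item $P_{16n+14}=P_{16n+3}+P_{8n+7}-P_{8n+3}-P_{8n+2}-P_{4n+3}+3P_{4n+2}-P_{2n+1}$ \item $P_{16n+15}=P_{16n+3}+2P_{8n+7}-3P_{8n+6}-2P_{8n+3}+6P_{4n+2}-3P_{2n+1}$ \item $P_{32n+3}=P_{8n+3}$ \item $P_{32n+19}=-P_{16n+3}+P_{8n+3}+3P_{8n+2}+2P_{4n+3}-3P_{4n+2}-P_{2n+1}$ \end{enumerate} (3) These relations express every subsequence in the 2-kernel other than $(P_n)$, $(P_{2n})$ and $(P_{4n})$ as a $\mathbb{Z}$-combination of the nine subsequences $(P_{2n+1})$, $(P_{4n+2})$, $(P_{4n+3})$, $(P_{8n})$, $(P_{8n+2})$, $(P_{8n+3})$, $(P_{8n+6})$,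 $(P_{8n+7})$, $(P_{16n+3})$. More precisely, for every integer sequence $(a_n)_{n\ge 0}$ that satisfies the 13 relations for all $n\ge0$ (with $a$ in place of $P$), every $e\ge 0$ and every $0\le c<2^e$ with $(e,c)\notin\{(0,0),(1,0),(2,0)\}$, the sequence $(a_{2^e n+c})_{n\ge 0}$ lies in the $\mathbb{Z}$-span of the nine corresponding subsequences of $(a_n)$. (4) Consequently the $\mathbb{Z}$-module generated by the 2-kernel of $(P_n)_{n\ge 0}$ is generated by these nine subsequences together with $(P_n)$, $(P_{2n})$ and $(P_{4n})$. -/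

import Mathlib

namespace TwoAbelian

section Words

variable {A : Type*}

/-- The finite factors of length `n` of the infinite word `w = w 0, w 1, w 2, …`
(the set `T_n` when `w` is the Thue–Morse word). -/
def factors (w : ℕ → A) (n : ℕ) : Set (List A) :=
  {u | ∃ i : ℕ, u = (List.range n).map fun j => w (i + j)}

/-- The prefix of length `l` of `u` (all of `u` if `u` is shorter). -/
def pref (l : ℕ) (u : List A) : List A := u.take l

/-- The suffix of length `l` of `u` (all of `u` if `u` is shorter). -/
def suff (l : ℕ) (u : List A) : List A := u.drop (u.length - l)

/-- `|u|_v`: the number of (possibly overlapping) occurrences of `v` in `u`, that is, the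
number of suffixes of `u` which start with `v`. -/
def occ [DecidableEq A] (v u : List A) : ℕ := u.tails.countP fun s => decide (v <+: s)

/-- `l`-abelian equivalence (for `l ≥ 1`) of finite words. -/
def AbEquiv [DecidableEq A] (l : ℕ) (u v : List A) : Prop :=
  (pref (l - 1) u = pref (l - 1) v ∧ suff (l - 1) u = suff (l - 1) v) ∧
    ∀ w : List A, w.length = l → occ w u = occ w v

/-- `l`-abelian equivalence as an equivalence relation on the factors of length `n` of `w`. -/
def abSetoid [DecidableEq A] (l : ℕ) (w : ℕ → A) (n : ℕ) : Setoid (factors w n) where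
  r u v := AbEquiv l u.1 v.1
  iseqv :=
    { refl := fun _ => ⟨⟨rfl, rfl⟩, fun _ _ => rfl⟩
      symm := fun h => ⟨⟨h.1.1.symm, h.1.2.symm⟩, fun w hw => (h.2 w hw).symm⟩
      trans := fun h h' =>
        ⟨⟨h.1.1.trans h'.1.1, h.1.2.trans h'.1.2⟩, fun w hw => (h.2 w hw).trans (h'.2 w hw)⟩ }

/-- The `l`-abelian complexity of the infinite word `w`: the number of classes of
`l`-abelian equivalence on its factors of length `n`.  (Over a finite alphabet there are
finitely many factors of length `n`, so `Nat.card` is the true number of classes.) -/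
noncomputable def abComplexity [DecidableEq A] (l : ℕ) (w : ℕ → A) (n : ℕ) : ℕ :=
  Nat.card (Quotient (abSetoid l w n))

end Words

section ThueMorse

/-- The Thue–Morse morphism `0 ↦ 01`, `1 ↦ 10` on finite binary words. -/
def tmMorphism (u : List (Fin 2)) : List (Fin 2) :=
  u.flatMap fun a => if a = 0 then [0, 1] else [1, 0]

/-- The word `m^q(0)`, of length `2^q`. -/
def tmPrefix (q : ℕ) : List (Fin 2) := tmMorphism^[q] [0]

/-- The infinite Thue–Morse word `t = lim m^q(0)`: its letter `t_n` is the letter with index `n`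
of `m^n(0)`, a word of length `2^n > n`.  That every `m^q(0)` is a prefix of `t` is
`tmPrefix_eq`. -/
def thueMorse (n : ℕ) : Fin 2 := (tmPrefix n).getD n 0

theorem length_tmMorphism (u : List (Fin 2)) : (tmMorphism u).length = 2 * u.length := by
  induction u with
  | nil => rfl
  | cons a u ih =>
    have h : tmMorphism (a :: u) = (if a = 0 then [0, 1] else [1, 0]) ++ tmMorphism u := rfl
    rw [h, List.length_append, ih]
    split_ifs <;> simp <;> omega

theorem tmPrefix_succ (q : ℕ) : tmPrefix (q + 1) = tmMorphism (tmPrefix q) :=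
  Function.iterate_succ_apply' _ _ _

theorem length_tmPrefix (q : ℕ) : (tmPrefix q).length = 2 ^ q := by
  induction q with
  | zero => rfl
  | succ q ih => rw [tmPrefix_succ, length_tmMorphism, ih, pow_succ, mul_comm]

theorem tmPrefix_prefix_succ (q : ℕ) : tmPrefix q <+: tmPrefix (q + 1) := by
  induction q with
  | zero => exact ⟨[1], rfl⟩
  | succ q ih =>
    obtain ⟨s, hs⟩ := ih
    refine ⟨tmMorphism s, ?_⟩
    have h : tmMorphism (tmPrefix q ++ s) = tmMorphism (tmPrefix q) ++ tmMorphism s := by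
      simp [tmMorphism]
    rw [tmPrefix_succ (q + 1), ← hs, h, hs, tmPrefix_succ q]

theorem tmPrefix_prefix {p q : ℕ} (h : p ≤ q) : tmPrefix p <+: tmPrefix q := by
  induction q, h using Nat.le_induction with
  | base => exact List.prefix_rfl
  | succ q _ ih => exact ih.trans (tmPrefix_prefix_succ q)

/-- Every `m^q(0)` is the prefix of length `2^q` of the Thue–Morse word. -/
theorem tmPrefix_eq (q : ℕ) : tmPrefix q = (List.range (2 ^ q)).map thueMorse := by
  have key : ∀ {p q i : ℕ}, p ≤ q → i < 2 ^ p → (tmPrefix p)[i]? = (tmPrefix q)[i]? := by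
    intro p q i h hi
    obtain ⟨s, hs⟩ := tmPrefix_prefix h
    rw [← hs, List.getElem?_append_left (by rw [length_tmPrefix]; exact hi)]
  apply List.ext_getElem
  · simp [length_tmPrefix]
  · intro i h1 h2
    have hq : i < 2 ^ q := by rwa [length_tmPrefix] at h1
    have hi : i < 2 ^ i := Nat.lt_two_pow_self
    have e : (tmPrefix i)[i]? = (tmPrefix q)[i]? := by
      rcases le_total i q with h | h
      · exact key h hi
      · exact (key h hq).symm
    simp [thueMorse, List.getD_eq_getElem?_getD, e, List.getElem?_eq_getElem h1]

/-- `P_n`, the 2-abelian complexity of the Thue–Morse word, as an integer sequence. -/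
noncomputable def P (n : ℕ) : ℤ := (abComplexity 2 thueMorse n : ℤ)

end ThueMorse

section Regular

/-- The subsequence `(a (p n + c))_{n ≥ 0}`. -/
def subseq (a : ℕ → ℤ) (p c : ℕ) : ℕ → ℤ := fun n => a (p * n + c)

/-- The `k`-kernel of an integer sequence. -/
def kernel (k : ℕ) (a : ℕ → ℤ) : Set (ℕ → ℤ) :=
  {b | ∃ e c : ℕ, c < k ^ e ∧ b = subseq a (k ^ e) c}

/-- `k`-regularity (for `k ≥ 2`): the `ℤ`-module generated by the `k`-kernel is finitely
generated. -/
def IsRegular (k : ℕ) (a : ℕ → ℤ) : Prop := (Submodule.span ℤ (kernel k a)).FG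

/-- The 13 linear relations, for an integer sequence `a`. -/
def Relations (a : ℕ → ℤ) : Prop :=
  (∀ n, a (4 * n + 1) = a (2 * n + 1)) ∧
  (∀ n, a (8 * n + 4) = a (8 * n + 3) + a (4 * n + 3) - a (4 * n + 2)) ∧
  (∀ n, a (16 * n) = a (8 * n)) ∧
  (∀ n, a (16 * n + 2) = a (8 * n + 2)) ∧
  (∀ n, a (16 * n + 6) = -a (16 * n + 3) + a (8 * n + 3) + 3 * a (8 * n + 2) + a (4 * n + 3)
    - 2 * a (4 * n + 2) - a (2 * n + 1)) ∧
  (∀ n, a (16 * n + 7) = -a (16 * n + 3) + a (8 * n + 3) + 3 * a (8 * n + 2) + 2 * a (4 * n + 3)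
    - 3 * a (4 * n + 2) - a (2 * n + 1)) ∧
  (∀ n, a (16 * n + 8) = a (8 * n + 2) + a (4 * n + 3) - a (2 * n + 1)) ∧
  (∀ n, a (16 * n + 10) = a (8 * n + 2) + a (4 * n + 3) - a (2 * n + 1)) ∧
  (∀ n, a (16 * n + 11) = -a (16 * n + 3) + 3 * a (8 * n + 2) + a (4 * n + 3)
    - 2 * a (2 * n + 1)) ∧
  (∀ n, a (16 * n + 14) = a (16 * n + 3) + a (8 * n + 7) - a (8 * n + 3) - a (8 * n + 2)
    - a (4 * n + 3) + 3 * a (4 * n + 2) - a (2 * n + 1)) ∧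
  (∀ n, a (16 * n + 15) = a (16 * n + 3) + 2 * a (8 * n + 7) - 3 * a (8 * n + 6)
    - 2 * a (8 * n + 3) + 6 * a (4 * n + 2) - 3 * a (2 * n + 1)) ∧
  (∀ n, a (32 * n + 3) = a (8 * n + 3)) ∧
  (∀ n, a (32 * n + 19) = -a (16 * n + 3) + a (8 * n + 3) + 3 * a (8 * n + 2)
    + 2 * a (4 * n + 3) - 3 * a (4 * n + 2) - a (2 * n + 1))

/-- The nine fixed subsequences of `a`. -/
def nine (a : ℕ → ℤ) : Set (ℕ → ℤ) :=
  {subseq a 2 1, subseq a 4 2, subseq a 4 3, subseq a 8 0, subseq a 8 2, subseq a 8 3,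
    subseq a 8 6, subseq a 8 7, subseq a 16 3}

end Regular

end TwoAbelian

/-!
The 2-abelian class of a factor of length `n + 1` of `t` is determined by its first letter, by its
number `c` of letter changes and, when `n + c` is odd, by the parity of its position. A factor and
its complement have the same changes and occur at positions of the same parity, so `P (n + 1)` is
twice the number of values of `c`, each counted double when `n + c` is odd and `c` is attained at
both parities.

The word of letter changes of `t` is obtained from itself by writing a `1` at the even positions and
the complement of its `j`-th letter at position `2 * j + 1`. Its windows of length `n` therefore
have counts filling an interval whose endpoints for lengths `2 * n` and `2 * n + 1` are given by
those for `n` and `n + 1`. This expresses `P` on each residue class modulo a power of two through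
the endpoints and their halves, and the 13 relations become integer identities with floors.
-/

namespace TwoAbelian

section Windows

theorem exists_eq_of_le_of_le {f : ℕ → ℕ} (hup : ∀ i, f (i + 1) ≤ f i + 1)
    (hdown : ∀ i, f i ≤ f (i + 1) + 1) {i j c : ℕ} (hi : f i ≤ c) (hj : c ≤ f j) :
    ∃ k, f k = c := by
  have crossing : ∀ {i j : ℕ}, i ≤ j → f i ≤ c ∧ c ≤ f j ∨ f j ≤ c ∧ c ≤ f i → ∃ k, f k = c := by
    intro i j hij
    induction j, hij using Nat.le_induction with
    | base => exact fun h => ⟨i, by omega⟩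
    | succ j _ ih =>
      intro h
      by_cases hc : f (j + 1) = c
      · exact ⟨j + 1, hc⟩
      · have := hup j
        have := hdown j
        exact ih (by omega)
  rcases le_total i j with hij | hij
  exacts [crossing hij (.inl ⟨hi, hj⟩), crossing hij (.inr ⟨hi, hj⟩)]

variable (p : ℕ → Prop) [DecidablePred p]

/-- The number of positions in the window `[i, i + n)` at which `p` holds. -/
def windowCount (i n : ℕ) : ℕ := Nat.count (fun k => p (i + k)) n

theorem count_add_windowCount (i n : ℕ) :
    Nat.count p i + windowCount p i n = Nat.count p (i + n) :=
  (Nat.count_add p i n).symm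

@[simp]
theorem windowCount_zero (i : ℕ) : windowCount p i 0 = 0 := Nat.count_zero _

theorem windowCount_succ (i n : ℕ) :
    windowCount p i (n + 1) = windowCount p i n + if p (i + n) then 1 else 0 :=
  Nat.count_succ _ _

theorem windowCount_succ' (i n : ℕ) :
    windowCount p i (n + 1) = windowCount p (i + 1) n + if p i then 1 else 0 := by
  have h := count_add_windowCount p i (n + 1)
  have h' := count_add_windowCount p (i + 1) n
  rw [Nat.count_succ, show i + 1 + n = i + (n + 1) by ring] at h'
  omega

theorem windowCount_le (i n : ℕ) : windowCount p i n ≤ n := Nat.count_le _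

theorem windowCount_mono_succ (i n : ℕ) : windowCount p i n ≤ windowCount p i (n + 1) :=
  Nat.count_monotone _ n.le_succ

theorem windowCount_succ_le (i n : ℕ) : windowCount p i (n + 1) ≤ windowCount p i n + 1 := by
  rw [windowCount_succ]
  split_ifs <;> omega

/-- The least number of positions satisfying `p` in a window of length `n`. -/
noncomputable def minWindowCount (n : ℕ) : ℕ := sInf (Set.range fun i => windowCount p i n)

/-- The largest number of positions satisfying `p` in a window of length `n`. -/
noncomputable def maxWindowCount (n : ℕ) : ℕ := sSup (Set.range fun i => windowCount p i n)

theorem bddAbove_range_windowCount (n : ℕ) :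
    BddAbove (Set.range fun i => windowCount p i n) :=
  ⟨n, Set.forall_mem_range.2 fun i => windowCount_le p i n⟩

theorem minWindowCount_le (i n : ℕ) : minWindowCount p n ≤ windowCount p i n :=
  Nat.sInf_le ⟨i, rfl⟩

theorem le_maxWindowCount (i n : ℕ) : windowCount p i n ≤ maxWindowCount p n :=
  le_csSup (bddAbove_range_windowCount p n) ⟨i, rfl⟩

theorem exists_windowCount_eq_min (n : ℕ) : ∃ i, windowCount p i n = minWindowCount p n :=
  Nat.sInf_mem (Set.range_nonempty fun i => windowCount p i n)

theorem exists_windowCount_eq_max (n : ℕ) : ∃ i, windowCount p i n = maxWindowCount p n :=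
  Nat.sSup_mem (Set.range_nonempty _) (bddAbove_range_windowCount p n)

theorem exists_windowCount_eq_iff {n c : ℕ} :
    (∃ i, windowCount p i n = c) ↔ minWindowCount p n ≤ c ∧ c ≤ maxWindowCount p n := by
  refine ⟨?_, fun ⟨hmin, hmax⟩ => ?_⟩
  · rintro ⟨i, rfl⟩
    exact ⟨minWindowCount_le p i n, le_maxWindowCount p i n⟩
  · obtain ⟨i, hi⟩ := exists_windowCount_eq_min p n
    obtain ⟨j, hj⟩ := exists_windowCount_eq_max p n
    have slide (k : ℕ) := (windowCount_succ' p k n).symm.trans (windowCount_succ p k n)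
    refine exists_eq_of_le_of_le (fun k => ?_) (fun k => ?_) (hi.trans_le hmin)
      (hmax.trans_eq hj.symm) <;>
    · have := slide k
      split_ifs at this <;> omega

theorem range_windowCount (n : ℕ) :
    (Set.range fun i => windowCount p i n) = Set.Icc (minWindowCount p n) (maxWindowCount p n) :=
  Set.ext fun _ => exists_windowCount_eq_iff p

theorem minWindowCount_le_max (n : ℕ) : minWindowCount p n ≤ maxWindowCount p n :=
  (minWindowCount_le p 0 n).trans (le_maxWindowCount p 0 n)

theorem minWindowCount_mono_succ (n : ℕ) : minWindowCount p n ≤ minWindowCount p (n + 1) := by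
  obtain ⟨i, hi⟩ := exists_windowCount_eq_min p (n + 1)
  exact hi ▸ (minWindowCount_le p i n).trans (windowCount_mono_succ p i n)

theorem minWindowCount_succ_le (n : ℕ) : minWindowCount p (n + 1) ≤ minWindowCount p n + 1 := by
  obtain ⟨i, hi⟩ := exists_windowCount_eq_min p n
  exact hi ▸ (minWindowCount_le p i (n + 1)).trans (windowCount_succ_le p i n)

theorem maxWindowCount_mono_succ (n : ℕ) : maxWindowCount p n ≤ maxWindowCount p (n + 1) := by
  obtain ⟨i, hi⟩ := exists_windowCount_eq_max p n
  exact hi ▸ (windowCount_mono_succ p i n).trans (le_maxWindowCount p i (n + 1))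

end Windows

section Classes

variable {A : Type*}

/-- The factor of length `n` of the infinite word `w` at position `i`. -/
def factorAt (w : ℕ → A) (i n : ℕ) : List A := (List.range n).map fun k => w (i + k)

theorem length_factorAt (w : ℕ → A) (i n : ℕ) : (factorAt w i n).length = n := by
  simp [factorAt]

theorem factorAt_succ (w : ℕ → A) (i n : ℕ) :
    factorAt w i (n + 1) = factorAt w i n ++ [w (i + n)] := by
  simp [factorAt, List.range_succ]

theorem factorAt_succ' (w : ℕ → A) (i n : ℕ) :
    factorAt w i (n + 1) = w i :: factorAt w (i + 1) n := by
  simp [factorAt, List.range_succ_eq_map, Function.comp_def, Nat.add_assoc, Nat.add_comm 1]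

theorem pref_one_factorAt_succ (w : ℕ → A) (i n : ℕ) :
    pref 1 (factorAt w i (n + 1)) = [w i] := by
  simp [pref, factorAt_succ']

theorem suff_one_factorAt_succ (w : ℕ → A) (i n : ℕ) :
    suff 1 (factorAt w i (n + 1)) = [w (i + n)] := by
  rw [suff, length_factorAt, factorAt_succ]
  exact List.drop_left' (length_factorAt w i n)

variable [DecidableEq A]

/-- The number of occurrences of the word `xy` in the factor of length `n + 1` of `w` at
position `i`. -/
def pairCount (w : ℕ → A) (x y : A) (i n : ℕ) : ℕ :=
  windowCount (fun k => w k = x ∧ w (k + 1) = y) i n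

/-- The number of letter changes `w k ≠ w (k + 1)` in the factor of length `n + 1` of `w` at
position `i`. -/
def changes (w : ℕ → A) (i n : ℕ) : ℕ := windowCount (fun k => w k ≠ w (k + 1)) i n

theorem occ_pair_factorAt_succ (w : ℕ → A) (x y : A) (i n : ℕ) :
    occ [x, y] (factorAt w i (n + 1)) = pairCount w x y i n := by
  induction n generalizing i with
  | zero => simp [factorAt, occ, pairCount]
  | succ n ih =>
    rw [pairCount, windowCount_succ', ← pairCount, ← ih, factorAt_succ', occ, List.tails,
      List.countP_cons, occ, factorAt_succ']
    simp only [List.cons_prefix_cons, List.nil_prefix, and_true, decide_eq_true_eq,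
      eq_comm (a := x), eq_comm (a := y)]

theorem abEquiv_two_factorAt_succ_iff (w : ℕ → A) (i j n : ℕ) :
    AbEquiv 2 (factorAt w i (n + 1)) (factorAt w j (n + 1)) ↔
      (w i = w j ∧ w (i + n) = w (j + n)) ∧
        ∀ x y, pairCount w x y i n = pairCount w x y j n := by
  simp only [AbEquiv, Nat.add_one_sub_one, pref_one_factorAt_succ, suff_one_factorAt_succ,
    List.singleton_inj, List.length_eq_two]
  refine and_congr_right fun _ => ⟨fun h x y => ?_, ?_⟩
  · simpa only [occ_pair_factorAt_succ] using h _ ⟨x, y, rfl⟩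
  · rintro h _ ⟨x, y, rfl⟩
    simpa only [occ_pair_factorAt_succ] using h x y

theorem abComplexity_eq_ncard_range {B : Type*} {l : ℕ} {w : ℕ → A} {n : ℕ} {f : ℕ → B}
    (hf : ∀ i j, AbEquiv l (factorAt w i n) (factorAt w j n) ↔ f i = f j) :
    abComplexity l w n = (Set.range f).ncard := by
  let toClass (i : ℕ) : Quotient (abSetoid l w n) := ⟦⟨factorAt w i n, i, rfl⟩⟧
  have surjective_toClass : Function.Surjective toClass := by
    rintro ⟨_, i, rfl⟩
    exact ⟨i, rfl⟩
  have ker_eq : Setoid.ker toClass = Setoid.ker f :=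
    Setoid.ext fun i j => Quotient.eq.trans (hf i j)
  calc abComplexity l w n
      = Nat.card (Quotient (Setoid.ker toClass)) :=
        Nat.card_congr (Setoid.quotientKerEquivOfSurjective _ surjective_toClass).symm
    _ = Nat.card (Quotient (Setoid.ker f)) := by rw [ker_eq]
    _ = (Set.range f).ncard := Nat.card_congr (Setoid.quotientKerEquivRange f)

end Classes

section BinaryWords

variable (w : ℕ → Fin 2) (i n : ℕ)

theorem val_apply_add : (w (i + n) : ℕ) = (w i + changes w i n) % 2 := by
  induction n with
  | zero =>
    simp only [add_zero, changes, windowCount_zero]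
    omega
  | succ n ih =>
    rw [changes, windowCount_succ, ← changes, ← Nat.add_assoc]
    split_ifs <;> omega

theorem pairCount_zero_one_add_one_zero :
    pairCount w 0 1 i n + pairCount w 1 0 i n = changes w i n := by
  induction n with
  | zero => simp [pairCount, changes]
  | succ n ih =>
    simp only [pairCount, changes, windowCount_succ] at ih ⊢
    split_ifs <;> omega

theorem pairCount_zero_one_add_val :
    pairCount w 0 1 i n + w i = pairCount w 1 0 i n + w (i + n) := by
  induction n with
  | zero => simp [pairCount]
  | succ n ih =>
    simp only [pairCount, windowCount_succ, ← Nat.add_assoc] at ih ⊢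
    split_ifs <;> omega

theorem pairCount_zero_zero_add_one_one_add_changes :
    pairCount w 0 0 i n + pairCount w 1 1 i n + changes w i n = n := by
  induction n with
  | zero => simp [pairCount, changes]
  | succ n ih =>
    simp only [pairCount, changes, windowCount_succ] at ih ⊢
    split_ifs <;> omega

theorem abEquiv_two_factorAt_succ_iff_of_binary (j : ℕ) :
    AbEquiv 2 (factorAt w i (n + 1)) (factorAt w j (n + 1)) ↔
      w i = w j ∧ changes w i n = changes w j n ∧
        pairCount w 1 1 i n = pairCount w 1 1 j n := by
  have := pairCount_zero_one_add_one_zero w i n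
  have := pairCount_zero_one_add_one_zero w j n
  have := pairCount_zero_one_add_val w i n
  have := pairCount_zero_one_add_val w j n
  have := pairCount_zero_zero_add_one_one_add_changes w i n
  have := pairCount_zero_zero_add_one_one_add_changes w j n
  have := val_apply_add w i n
  have := val_apply_add w j n
  rw [abEquiv_two_factorAt_succ_iff]
  simp only [Fin.forall_fin_two]
  omega

end BinaryWords

section ThueMorseWord

theorem tmMorphism_cons (a : Fin 2) (u : List (Fin 2)) :
    tmMorphism (a :: u) = a :: (1 - a) :: tmMorphism u := by
  fin_cases a <;> rfl

theorem getElem?_tmMorphism (u : List (Fin 2)) (k : ℕ) :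
    (tmMorphism u)[k]? = u[k / 2]?.map fun a => if k % 2 = 0 then a else 1 - a := by
  induction u generalizing k with
  | nil => rfl
  | cons a u ih =>
    rw [tmMorphism_cons]
    match k with
    | 0 => simp
    | 1 => simp
    | k + 2 => simp [ih]

theorem thueMorse_eq_ite (k : ℕ) :
    thueMorse k = if k % 2 = 0 then thueMorse (k / 2) else 1 - thueMorse (k / 2) := by
  have getElem?_tmPrefix {q k : ℕ} (hk : k < 2 ^ q) : (tmPrefix q)[k]? = some (thueMorse k) := by
    simp [tmPrefix_eq, hk]
  have hk : k < 2 ^ k := Nat.lt_two_pow_self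
  have h := getElem?_tmMorphism (tmPrefix k) k
  rw [← tmPrefix_succ, getElem?_tmPrefix (by omega), getElem?_tmPrefix (by omega)] at h
  exact Option.some_injective _ h

theorem val_thueMorse (k : ℕ) : (thueMorse k : ℕ) = (thueMorse (k / 2) + k) % 2 := by
  rw [thueMorse_eq_ite k]
  split_ifs <;> omega

theorem val_thueMorse_add_two_pow {q k : ℕ} (hk : k < 2 ^ q) :
    (thueMorse (k + 2 ^ q) : ℕ) = 1 - thueMorse k := by
  induction q generalizing k with
  | zero =>
    obtain rfl : k = 0 := by omega
    rfl
  | succ q ih =>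
    have half : (k + 2 ^ (q + 1)) / 2 = k / 2 + 2 ^ q := by omega
    rw [val_thueMorse, half, ih (by omega), val_thueMorse k]
    omega

theorem count_change_add_count_half (k : ℕ) :
    Nat.count (fun j => thueMorse j ≠ thueMorse (j + 1)) k +
      Nat.count (fun j => thueMorse j ≠ thueMorse (j + 1)) (k / 2) = k := by
  induction k with
  | zero => rfl
  | succ k ih =>
    have letter := val_thueMorse k
    have next_letter := val_thueMorse (k + 1)
    obtain hk | hk : (k + 1) / 2 = k / 2 ∨ (k + 1) / 2 = k / 2 + 1 := by omega
    · rw [hk] at next_letter ⊢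
      rw [Nat.count_succ]
      split_ifs <;> omega
    · rw [hk] at next_letter ⊢
      rw [Nat.count_succ, Nat.count_succ]
      split_ifs <;> omega

theorem changes_thueMorse_add_changes_half (i n : ℕ) :
    changes thueMorse i n + changes thueMorse (i / 2) ((i + n) / 2 - i / 2) = n := by
  have h := count_change_add_count_half i
  have h' := count_change_add_count_half (i + n)
  rw [← count_add_windowCount, show (i + n) / 2 = i / 2 + ((i + n) / 2 - i / 2) by omega,
    ← count_add_windowCount] at h'
  unfold changes
  omega

theorem changes_thueMorse_two_mul (i n : ℕ) :
    changes thueMorse i (2 * n) + changes thueMorse (i / 2) n = 2 * n := by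
  convert changes_thueMorse_add_changes_half i (2 * n) using 3
  omega

theorem changes_thueMorse_even_odd (j n : ℕ) :
    changes thueMorse (2 * j) (2 * n + 1) + changes thueMorse j n = 2 * n + 1 := by
  convert changes_thueMorse_add_changes_half (2 * j) (2 * n + 1) using 3 <;> omega

theorem changes_thueMorse_odd_odd (j n : ℕ) :
    changes thueMorse (2 * j + 1) (2 * n + 1) + changes thueMorse j (n + 1) = 2 * n + 1 := by
  convert changes_thueMorse_add_changes_half (2 * j + 1) (2 * n + 1) using 3 <;> omega

-- The letters of `t` sum to `1` over each block `t (2 * j), t (2 * j + 1)`, so the sums of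
-- consecutive letters telescope.
theorem two_mul_pairCount_thueMorse (i n : ℕ) :
    2 * pairCount thueMorse 1 1 i n + changes thueMorse i n + thueMorse (i / 2) =
      n + thueMorse ((i + n) / 2) := by
  induction n with
  | zero => simp [pairCount, changes]
  | succ n ih =>
    have letter := val_thueMorse (i + n)
    have next_letter := val_thueMorse (i + n + 1)
    simp only [pairCount, changes, windowCount_succ, ← Nat.add_assoc] at ih ⊢
    obtain half | half : (i + n + 1) / 2 = (i + n) / 2 ∨ (i + n) % 2 = 1 := by omega
    · rw [half] at next_letter ⊢
      split_ifs <;> omega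
    · split_ifs <;> omega

/-- A complete invariant of the 2-abelian class of the factor of length `n + 1` of the Thue–Morse
word at position `i`: its first letter, its number of letter changes and, when these changes are
not congruent to `n` modulo 2, the parity of `i`. -/
def classKey (n i : ℕ) : Fin 2 × ℕ × Bool :=
  (thueMorse i, changes thueMorse i n, decide ((n + changes thueMorse i n) % 2 = 1 ∧ i % 2 = 1))

theorem abEquiv_thueMorse_iff_classKey_eq (n i j : ℕ) :
    AbEquiv 2 (factorAt thueMorse i (n + 1)) (factorAt thueMorse j (n + 1)) ↔
      classKey n i = classKey n j := by
  have := two_mul_pairCount_thueMorse i n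
  have := two_mul_pairCount_thueMorse j n
  have := val_apply_add thueMorse i n
  have := val_apply_add thueMorse j n
  have := val_thueMorse i
  have := val_thueMorse j
  have := val_thueMorse (i + n)
  have := val_thueMorse (j + n)
  simp only [abEquiv_two_factorAt_succ_iff_of_binary, classKey, Prod.mk.injEq, decide_eq_decide]
  refine and_congr_right fun _ => and_congr_right fun _ => ?_
  omega

theorem P_succ_eq_ncard_range (n : ℕ) : P (n + 1) = (Set.range (classKey n)).ncard :=
  congrArg Nat.cast (abComplexity_eq_ncard_range fun i j => abEquiv_thueMorse_iff_classKey_eq n i j)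

end ThueMorseWord

section Counting

open scoped Finset

theorem exists_thueMorse_eq_and_changes_eq (x : Fin 2) (i n : ℕ) :
    ∃ j, thueMorse j = x ∧ changes thueMorse j n = changes thueMorse i n ∧ j % 2 = i % 2 := by
  by_cases hx : thueMorse i = x
  · exact ⟨i, hx, rfl, rfl⟩
  have complement (k : ℕ) (hk : k ≤ n) :
      (thueMorse (i + 2 ^ (i + n + 1) + k) : ℕ) = 1 - thueMorse (i + k) := by
    have : i + n + 1 < 2 ^ (i + n + 1) := Nat.lt_two_pow_self
    rw [add_right_comm]
    exact val_thueMorse_add_two_pow (by omega)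
  refine ⟨i + 2 ^ (i + n + 1), ?_, ?_, by omega⟩
  · have := complement 0 n.zero_le
    simp only [add_zero] at this
    omega
  · have changes_eq (m : ℕ) (hm : m ≤ n) :
        changes thueMorse (i + 2 ^ (i + n + 1)) m = changes thueMorse i m := by
      induction m with
      | zero => simp [changes]
      | succ m ih =>
        have := ih (by omega)
        have := complement m (by omega)
        have := complement (m + 1) hm
        simp only [changes, windowCount_succ, add_assoc] at *
        split_ifs <;> omega
    exact changes_eq n le_rfl

theorem range_classKey (n : ℕ) :
    Set.range (classKey n) = Set.univ ×ˢ Set.range fun i => (classKey n i).2 := by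
  ext ⟨x, y⟩
  simp only [Set.mem_range, Set.mem_prod, Set.mem_univ, true_and]
  refine ⟨fun ⟨i, hi⟩ => ⟨i, congrArg Prod.snd hi⟩, ?_⟩
  rintro ⟨i, rfl⟩
  obtain ⟨j, rfl, hchanges, hpar⟩ := exists_thueMorse_eq_and_changes_eq x i n
  exact ⟨j, by simp only [classKey, hchanges, hpar]⟩

theorem ncard_range_prodMk_bool {ι α : Type*} {f : ι → α} (hf : (Set.range f).Finite)
    (b : ι → Bool) :
    (Set.range fun i => (f i, b i)).ncard =
      (Set.range f).ncard + (f '' {i | b i = true} ∩ f '' {i | b i = false}).ncard := by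
  set S := f '' {i | b i = true}
  set T := f '' {i | b i = false}
  have hS : S.Finite := hf.subset (Set.image_subset_range _ _)
  have hT : T.Finite := hf.subset (Set.image_subset_range _ _)
  have range_eq : (Set.range fun i => (f i, b i)) = (·, true) '' S ∪ (·, false) '' T := by
    ext ⟨x, _ | _⟩ <;> simp [S, T, and_comm]
  have union_eq : S ∪ T = Set.range f := by
    rw [← Set.image_union, ← Set.image_univ]
    congr 1
    ext i
    simp
  have disjoint : Disjoint ((·, true) '' S) ((·, false) '' T) := by
    simp [Set.disjoint_left]
  rw [range_eq, Set.ncard_union_eq disjoint (hS.image _) (hT.image _),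
    Set.ncard_image_of_injective _ (Prod.mk_left_injective _),
    Set.ncard_image_of_injective _ (Prod.mk_left_injective _),
    ← Set.ncard_union_add_ncard_inter S T hS hT, union_eq]

theorem ncard_range_classKey (n : ℕ) :
    (Set.range (classKey n)).ncard = 2 * ((Set.range (changes thueMorse · n)).ncard +
      {c | (n + c) % 2 = 1 ∧ (∃ j, changes thueMorse (2 * j) n = c) ∧
        ∃ j, changes thueMorse (2 * j + 1) n = c}.ncard) := by
  have hfin : (Set.range (changes thueMorse · n)).Finite :=
    (Set.finite_Iic n).subset (Set.range_subset_iff.2 fun i => windowCount_le _ i n)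
  rw [range_classKey, Set.ncard_prod, Set.ncard_univ, Nat.card_eq_fintype_card, Fintype.card_fin]
  simp only [classKey]
  rw [ncard_range_prodMk_bool hfin]
  congr 3
  ext c
  simp only [Set.mem_inter_iff, Set.mem_image, Set.mem_ofPred_eq, decide_eq_true_eq,
    decide_eq_false_iff_not]
  constructor
  · rintro ⟨⟨i, ⟨hc, hi⟩, rfl⟩, j, hj, hji⟩
    exact ⟨hc, ⟨j / 2, by rw [← hji]; congr 1; omega⟩, i / 2, by congr 1; omega⟩
  · rintro ⟨hc, ⟨j, hj⟩, i, rfl⟩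
    exact ⟨⟨2 * i + 1, by omega, rfl⟩, 2 * j, by omega, hj⟩

theorem ncard_setOf_mod_two_eq_one {a b : ℕ} (n : ℕ) (hab : a ≤ b) :
    {c | (n + c) % 2 = 1 ∧ a ≤ c ∧ c < b}.ncard = (n + b) / 2 - (n + a) / 2 := by
  have filter_card : #{c ∈ Finset.Ico a b | (n + c) % 2 = 1} =
      (n + b) / 2 - (n + a) / 2 := by
    induction b, hab using Nat.le_induction with
    | base => simp
    | succ b hab ih =>
      rw [← Finset.insert_Ico_right_eq_Ico_add_one hab, Finset.filter_insert]
      split_ifs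
      · rw [Finset.card_insert_of_notMem (by simp), ih]
        omega
      · rw [ih]
        omega
  rw [← filter_card, ← Set.ncard_coe_finset]
  congr 1
  ext c
  simp [and_comm]

end Counting

section Endpoints

/-- The least number of letter changes in a factor of length `n + 1` of the Thue–Morse word, as an
integer to allow subtraction. -/
noncomputable def minChanges (n : ℕ) : ℤ :=
  minWindowCount (fun k => thueMorse k ≠ thueMorse (k + 1)) n

/-- The largest number of letter changes in a factor of length `n + 1` of the Thue–Morse word, as an
integer to allow subtraction. -/
noncomputable def maxChanges (n : ℕ) : ℤ :=
  maxWindowCount (fun k => thueMorse k ≠ thueMorse (k + 1)) n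

theorem minChanges_le_changes (i n : ℕ) : minChanges n ≤ changes thueMorse i n :=
  Int.ofNat_le.2 (minWindowCount_le _ i n)

theorem changes_le_maxChanges (i n : ℕ) : (changes thueMorse i n : ℤ) ≤ maxChanges n :=
  Int.ofNat_le.2 (le_maxWindowCount _ i n)

theorem exists_changes_eq_minChanges (n : ℕ) : ∃ i, (changes thueMorse i n : ℤ) = minChanges n :=
  (exists_windowCount_eq_min _ n).imp fun _ => congrArg Nat.cast

theorem exists_changes_eq_maxChanges (n : ℕ) : ∃ i, (changes thueMorse i n : ℤ) = maxChanges n :=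
  (exists_windowCount_eq_max _ n).imp fun _ => congrArg Nat.cast

theorem exists_changes_eq_iff {n c : ℕ} :
    (∃ i, changes thueMorse i n = c) ↔ minChanges n ≤ c ∧ c ≤ maxChanges n := by
  simp only [minChanges, maxChanges, Nat.cast_le]
  exact exists_windowCount_eq_iff _

theorem minChanges_nonneg (n : ℕ) : 0 ≤ minChanges n :=
  Int.natCast_nonneg _

theorem minChanges_le_maxChanges (n : ℕ) : minChanges n ≤ maxChanges n :=
  Int.ofNat_le.2 (minWindowCount_le_max _ n)

theorem minChanges_mono_succ (n : ℕ) : minChanges n ≤ minChanges (n + 1) :=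
  Int.ofNat_le.2 (minWindowCount_mono_succ _ n)

theorem minChanges_succ_le (n : ℕ) : minChanges (n + 1) ≤ minChanges n + 1 :=
  Int.ofNat_le.2 (minWindowCount_succ_le _ n)

theorem maxChanges_mono_succ (n : ℕ) : maxChanges n ≤ maxChanges (n + 1) :=
  Int.ofNat_le.2 (maxWindowCount_mono_succ _ n)

theorem exists_eq_iff_of_add_changes_eq {f : ℕ → ℕ} {m N c : ℕ}
    (hf : ∀ j, f j + changes thueMorse j m = N) :
    (∃ j, f j = c) ↔ N - maxChanges m ≤ c ∧ c ≤ N - minChanges m := by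
  have reflect : (∃ j, f j = c) ↔ c ≤ N ∧ ∃ j, changes thueMorse j m = N - c := by
    constructor
    · rintro ⟨j, rfl⟩
      have := hf j
      exact ⟨by omega, j, by omega⟩
    · rintro ⟨hc, j, hj⟩
      have := hf j
      exact ⟨j, by omega⟩
  have := minChanges_nonneg m
  rw [reflect, exists_changes_eq_iff]
  omega

theorem minChanges_two_mul (n : ℕ) : minChanges (2 * n) = 2 * n - maxChanges n := by
  obtain ⟨i, hi⟩ := exists_changes_eq_minChanges (2 * n)
  obtain ⟨j, hj⟩ := exists_changes_eq_maxChanges n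
  have := changes_thueMorse_two_mul i n
  have := changes_thueMorse_two_mul (2 * j) n
  rw [Nat.mul_div_cancel_left j two_pos] at this
  have := changes_le_maxChanges (i / 2) n
  have := minChanges_le_changes (2 * j) (2 * n)
  omega

theorem maxChanges_two_mul (n : ℕ) : maxChanges (2 * n) = 2 * n - minChanges n := by
  obtain ⟨i, hi⟩ := exists_changes_eq_maxChanges (2 * n)
  obtain ⟨j, hj⟩ := exists_changes_eq_minChanges n
  have := changes_thueMorse_two_mul i n
  have := changes_thueMorse_two_mul (2 * j) n
  rw [Nat.mul_div_cancel_left j two_pos] at this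
  have := minChanges_le_changes (i / 2) n
  have := changes_le_maxChanges (2 * j) (2 * n)
  omega

theorem minChanges_two_mul_add_one (n : ℕ) :
    minChanges (2 * n + 1) = 2 * n + 1 - maxChanges (n + 1) := by
  obtain ⟨i, hi⟩ := exists_changes_eq_minChanges (2 * n + 1)
  obtain ⟨j, hj⟩ := exists_changes_eq_maxChanges (n + 1)
  have := changes_thueMorse_odd_odd j n
  have := minChanges_le_changes (2 * j + 1) (2 * n + 1)
  have := maxChanges_mono_succ n
  obtain ⟨k, rfl | rfl⟩ := i.even_or_odd'
  · have := changes_thueMorse_even_odd k n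
    have := changes_le_maxChanges k n
    omega
  · have := changes_thueMorse_odd_odd k n
    have := changes_le_maxChanges k (n + 1)
    omega

theorem maxChanges_two_mul_add_one (n : ℕ) :
    maxChanges (2 * n + 1) = 2 * n + 1 - minChanges n := by
  obtain ⟨i, hi⟩ := exists_changes_eq_maxChanges (2 * n + 1)
  obtain ⟨j, hj⟩ := exists_changes_eq_minChanges n
  have := changes_thueMorse_even_odd j n
  have := changes_le_maxChanges (2 * j) (2 * n + 1)
  have := minChanges_mono_succ n
  obtain ⟨k, rfl | rfl⟩ := i.even_or_odd'
  · have := changes_thueMorse_even_odd k n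
    have := minChanges_le_changes k n
    omega
  · have := changes_thueMorse_odd_odd k n
    have := minChanges_le_changes k (n + 1)
    omega

theorem minChanges_two_mul_add_two (n : ℕ) :
    minChanges (2 * n + 2) = 2 * n + 2 - maxChanges (n + 1) := by
  simpa [mul_add] using minChanges_two_mul (n + 1)

theorem maxChanges_two_mul_add_two (n : ℕ) :
    maxChanges (2 * n + 2) = 2 * n + 2 - minChanges (n + 1) := by
  simpa [mul_add] using maxChanges_two_mul (n + 1)

end Endpoints

section ClosedForms

theorem ncard_range_changes (n : ℕ) :
    ((Set.range (changes thueMorse · n)).ncard : ℤ) = maxChanges n - minChanges n + 1 := by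
  have := minChanges_le_maxChanges n
  have range_eq : Set.range (changes thueMorse · n) = Set.Icc _ _ := range_windowCount _ n
  rw [range_eq, Set.ncard_eq_toFinset_card', Set.toFinset_Icc, Nat.card_Icc]
  unfold minChanges maxChanges at *
  omega

theorem ncard_setOf_mod_two_eq_one_and_le {n : ℕ} {a b : ℤ} (ha : 0 ≤ a) (hab : a ≤ b + 1) :
    ({c : ℕ | (n + c) % 2 = 1 ∧ a ≤ c ∧ c ≤ b}.ncard : ℤ) = (n + b + 1) / 2 - (n + a) / 2 := by
  lift a to ℕ using ha
  obtain ⟨d, rfl⟩ : ∃ d : ℕ, b = d - 1 := ⟨(b + 1).toNat, by omega⟩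
  have := ncard_setOf_mod_two_eq_one n (a := a) (b := d) (by omega)
  simp only [Int.le_sub_one_iff, Nat.cast_le, Nat.cast_lt, this]
  omega

theorem P_succ (n : ℕ) :
    P (n + 1) = 2 * (maxChanges n - minChanges n + 1 +
      {c | (n + c) % 2 = 1 ∧ (∃ j, changes thueMorse (2 * j) n = c) ∧
        ∃ j, changes thueMorse (2 * j + 1) n = c}.ncard) := by
  rw [P_succ_eq_ncard_range, ncard_range_classKey, ← ncard_range_changes]
  norm_cast

theorem P_two_mul_add_one (n : ℕ) :
    P (2 * n + 1) =
      2 * (maxChanges n - minChanges n + 1 + (maxChanges n + 1) / 2 - minChanges n / 2) := by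
  have shared : {c | (2 * n + c) % 2 = 1 ∧ (∃ j, changes thueMorse (2 * j) (2 * n) = c) ∧
      ∃ j, changes thueMorse (2 * j + 1) (2 * n) = c} = {c : ℕ | (2 * n + c) % 2 = 1 ∧
        minChanges (2 * n) ≤ c ∧ c ≤ maxChanges (2 * n)} := by
    ext c
    have even_start := exists_eq_iff_of_add_changes_eq (c := c) (m := n) (N := 2 * n)
      fun j => by simpa using changes_thueMorse_two_mul (2 * j) n
    have odd_start := exists_eq_iff_of_add_changes_eq (c := c) (m := n) (N := 2 * n)
      fun j => by
        have := changes_thueMorse_two_mul (2 * j + 1) n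
        rwa [show (2 * j + 1) / 2 = j by omega] at this
    simp only [Set.mem_ofPred_eq, even_start, odd_start, minChanges_two_mul, maxChanges_two_mul,
      Nat.cast_mul, Nat.cast_ofNat, and_self]
  have := minChanges_le_maxChanges (2 * n)
  rw [P_succ, shared, ncard_setOf_mod_two_eq_one_and_le (minChanges_nonneg _) (by omega),
    minChanges_two_mul, maxChanges_two_mul]
  omega

theorem P_two_mul_add_two (n : ℕ) :
    P (2 * n + 2) = 2 * (maxChanges (n + 1) - minChanges n + 1 + (maxChanges n + 1) / 2 -
      minChanges (n + 1) / 2) := by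
  have shared : {c | (2 * n + 1 + c) % 2 = 1 ∧
      (∃ j, changes thueMorse (2 * j) (2 * n + 1) = c) ∧
        ∃ j, changes thueMorse (2 * j + 1) (2 * n + 1) = c} =
      {c : ℕ | (2 * n + 1 + c) % 2 = 1 ∧
        2 * n + 1 - maxChanges n ≤ c ∧ c ≤ 2 * n + 1 - minChanges (n + 1)} := by
    ext c
    have := minChanges_mono_succ n
    have := maxChanges_mono_succ n
    have even_start := exists_eq_iff_of_add_changes_eq (c := c) (N := 2 * n + 1)
      (changes_thueMorse_even_odd · n)
    have odd_start := exists_eq_iff_of_add_changes_eq (c := c) (N := 2 * n + 1)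
      (changes_thueMorse_odd_odd · n)
    simp only [Set.mem_ofPred_eq, even_start, odd_start]
    omega
  have := minChanges_le_maxChanges n
  have := minChanges_succ_le n
  have : 0 ≤ 2 * n + 1 - maxChanges n := by
    obtain ⟨i, hi⟩ := exists_changes_eq_maxChanges n
    have := changes_thueMorse_even_odd i n
    omega
  rw [P_succ, shared, ncard_setOf_mod_two_eq_one_and_le this (by omega),
    minChanges_two_mul_add_one, maxChanges_two_mul_add_one]
  omega

theorem P_four_mul_add_two (n : ℕ) :
    P (4 * n + 2) = 2 * (maxChanges n - minChanges n + 2 + maxChanges (n + 1) / 2 -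
      minChanges n / 2) := by
  have h := P_two_mul_add_two (2 * n)
  rw [← mul_assoc, minChanges_two_mul, maxChanges_two_mul, minChanges_two_mul_add_one,
    maxChanges_two_mul_add_one] at h
  lia

theorem P_four_mul_add_three (n : ℕ) :
    P (4 * n + 3) = 2 * (maxChanges (n + 1) - minChanges n + 2 + maxChanges (n + 1) / 2 -
      (minChanges n + 1) / 2) := by
  have h := P_two_mul_add_one (2 * n + 1)
  rw [show 2 * (2 * n + 1) + 1 = 4 * n + 3 by ring, minChanges_two_mul_add_one,
    maxChanges_two_mul_add_one] at h
  lia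

theorem P_four_mul_add_four (n : ℕ) :
    P (4 * n + 4) = 2 * (maxChanges (n + 1) - minChanges (n + 1) + 2 +
      (maxChanges (n + 1) + 1) / 2 - (minChanges n + 1) / 2) := by
  have h := P_two_mul_add_two (2 * n + 1)
  rw [show 2 * (2 * n + 1) + 2 = 4 * n + 4 by ring, minChanges_two_mul_add_one,
    maxChanges_two_mul_add_one, minChanges_two_mul_add_two, maxChanges_two_mul_add_two] at h
  lia

theorem P_eight_mul_add_two (n : ℕ) :
    P (8 * n + 2) = 2 * (maxChanges n - minChanges n + 2 + (maxChanges n + 1) / 2 -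
      minChanges n / 2) := by
  have h := P_four_mul_add_two (2 * n)
  rw [← mul_assoc, minChanges_two_mul, maxChanges_two_mul, maxChanges_two_mul_add_one] at h
  lia

theorem P_eight_mul_add_three (n : ℕ) :
    P (8 * n + 3) = 2 * (maxChanges n - minChanges n + 3 + maxChanges n / 2 -
      minChanges n / 2) := by
  have h := P_four_mul_add_three (2 * n)
  rw [← mul_assoc, minChanges_two_mul, maxChanges_two_mul_add_one] at h
  lia

theorem P_eight_mul_add_six (n : ℕ) :
    P (8 * n + 6) = 2 * (maxChanges (n + 1) - minChanges n + 3 + maxChanges (n + 1) / 2 -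
      (minChanges (n + 1) + 1) / 2) := by
  have h := P_four_mul_add_two (2 * n + 1)
  rw [show 4 * (2 * n + 1) + 2 = 8 * n + 6 by ring, minChanges_two_mul_add_one,
    maxChanges_two_mul_add_one, maxChanges_two_mul_add_two] at h
  lia

theorem P_eight_mul_add_seven (n : ℕ) :
    P (8 * n + 7) = 2 * (maxChanges (n + 1) - minChanges (n + 1) + 3 +
      (maxChanges (n + 1) + 1) / 2 - (minChanges (n + 1) + 1) / 2) := by
  have h := P_four_mul_add_three (2 * n + 1)
  rw [show 4 * (2 * n + 1) + 3 = 8 * n + 7 by ring, minChanges_two_mul_add_one,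
    maxChanges_two_mul_add_two] at h
  lia

theorem P_eight_mul_add_eight (n : ℕ) :
    P (8 * n + 8) = 2 * (maxChanges (n + 1) - minChanges (n + 1) + 2 +
      (maxChanges (n + 1) + 1) / 2 - minChanges (n + 1) / 2) := by
  have h := P_four_mul_add_four (2 * n + 1)
  rw [show 4 * (2 * n + 1) + 4 = 8 * n + 8 by ring, minChanges_two_mul_add_one,
    minChanges_two_mul_add_two, maxChanges_two_mul_add_two] at h
  lia

theorem P_sixteen_mul_add_three (n : ℕ) :
    P (16 * n + 3) = 2 * (maxChanges n - minChanges n + 3 + (maxChanges n + 1) / 2 -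
      (minChanges n + 1) / 2) := by
  have h := P_eight_mul_add_three (2 * n)
  rw [← mul_assoc, minChanges_two_mul, maxChanges_two_mul] at h
  lia

end ClosedForms

section Recurrences

theorem P_four_mul_add_one (n : ℕ) : P (4 * n + 1) = P (2 * n + 1) := by
  have h := P_two_mul_add_one (2 * n)
  rw [← mul_assoc, minChanges_two_mul, maxChanges_two_mul] at h
  rw [P_two_mul_add_one]
  lia

theorem P_eight_mul_add_four (n : ℕ) :
    P (8 * n + 4) = P (8 * n + 3) + P (4 * n + 3) - P (4 * n + 2) := by
  have h := P_four_mul_add_four (2 * n)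
  rw [← mul_assoc, minChanges_two_mul, minChanges_two_mul_add_one,
    maxChanges_two_mul_add_one] at h
  rw [P_eight_mul_add_three, P_four_mul_add_three, P_four_mul_add_two]
  lia

theorem P_sixteen_mul (n : ℕ) : P (16 * n) = P (8 * n) := by
  cases n with
  | zero => rfl
  | succ n =>
    have h := P_eight_mul_add_eight (2 * n + 1)
    have h' := P_eight_mul_add_eight n
    rw [minChanges_two_mul_add_two, maxChanges_two_mul_add_two] at h
    rw [show 16 * (n + 1) = 8 * (2 * n + 1) + 8 by ring, show 8 * (n + 1) = 8 * n + 8 by ring]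
    lia

theorem P_sixteen_mul_add_two (n : ℕ) : P (16 * n + 2) = P (8 * n + 2) := by
  have h := P_eight_mul_add_two (2 * n)
  rw [← mul_assoc, minChanges_two_mul, maxChanges_two_mul] at h
  rw [P_eight_mul_add_two]
  lia

theorem P_sixteen_mul_add_six (n : ℕ) :
    P (16 * n + 6) = -P (16 * n + 3) + P (8 * n + 3) + 3 * P (8 * n + 2) + P (4 * n + 3)
      - 2 * P (4 * n + 2) - P (2 * n + 1) := by
  have h := P_eight_mul_add_six (2 * n)
  rw [show 8 * (2 * n) + 6 = 16 * n + 6 by ring, minChanges_two_mul, minChanges_two_mul_add_one,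
    maxChanges_two_mul_add_one] at h
  rw [P_sixteen_mul_add_three, P_eight_mul_add_two, P_eight_mul_add_three, P_four_mul_add_three,
    P_four_mul_add_two, P_two_mul_add_one]
  lia

theorem P_sixteen_mul_add_seven (n : ℕ) :
    P (16 * n + 7) = -P (16 * n + 3) + P (8 * n + 3) + 3 * P (8 * n + 2) + 2 * P (4 * n + 3)
      - 3 * P (4 * n + 2) - P (2 * n + 1) := by
  have h := P_eight_mul_add_seven (2 * n)
  rw [show 8 * (2 * n) + 7 = 16 * n + 7 by ring, minChanges_two_mul_add_one,
    maxChanges_two_mul_add_one] at h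
  rw [P_sixteen_mul_add_three, P_eight_mul_add_two, P_eight_mul_add_three, P_four_mul_add_three,
    P_four_mul_add_two, P_two_mul_add_one]
  lia

theorem P_sixteen_mul_add_eight (n : ℕ) :
    P (16 * n + 8) = P (8 * n + 2) + P (4 * n + 3) - P (2 * n + 1) := by
  have h := P_eight_mul_add_eight (2 * n)
  rw [show 8 * (2 * n) + 8 = 16 * n + 8 by ring, minChanges_two_mul_add_one,
    maxChanges_two_mul_add_one] at h
  rw [P_eight_mul_add_two, P_four_mul_add_three, P_two_mul_add_one]
  lia

theorem P_sixteen_mul_add_ten (n : ℕ) :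
    P (16 * n + 10) = P (8 * n + 2) + P (4 * n + 3) - P (2 * n + 1) := by
  have h := P_eight_mul_add_two (2 * n + 1)
  rw [show 8 * (2 * n + 1) + 2 = 16 * n + 10 by ring, minChanges_two_mul_add_one,
    maxChanges_two_mul_add_one] at h
  rw [P_eight_mul_add_two, P_four_mul_add_three, P_two_mul_add_one]
  lia

theorem P_sixteen_mul_add_eleven (n : ℕ) :
    P (16 * n + 11) = -P (16 * n + 3) + 3 * P (8 * n + 2) + P (4 * n + 3)
      - 2 * P (2 * n + 1) := by
  have h := P_eight_mul_add_three (2 * n + 1)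
  rw [show 8 * (2 * n + 1) + 3 = 16 * n + 11 by ring, minChanges_two_mul_add_one,
    maxChanges_two_mul_add_one] at h
  rw [P_sixteen_mul_add_three, P_eight_mul_add_two, P_four_mul_add_three, P_two_mul_add_one]
  lia

theorem P_sixteen_mul_add_fourteen (n : ℕ) :
    P (16 * n + 14) = P (16 * n + 3) + P (8 * n + 7) - P (8 * n + 3) - P (8 * n + 2)
      - P (4 * n + 3) + 3 * P (4 * n + 2) - P (2 * n + 1) := by
  have h := P_eight_mul_add_six (2 * n + 1)
  rw [show 8 * (2 * n + 1) + 6 = 16 * n + 14 by ring, minChanges_two_mul_add_one,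
    minChanges_two_mul_add_two, maxChanges_two_mul_add_two] at h
  rw [P_sixteen_mul_add_three, P_eight_mul_add_two, P_eight_mul_add_three, P_eight_mul_add_seven,
    P_four_mul_add_three, P_four_mul_add_two, P_two_mul_add_one]
  lia

theorem P_sixteen_mul_add_fifteen (n : ℕ) :
    P (16 * n + 15) = P (16 * n + 3) + 2 * P (8 * n + 7) - 3 * P (8 * n + 6)
      - 2 * P (8 * n + 3) + 6 * P (4 * n + 2) - 3 * P (2 * n + 1) := by
  have h := P_eight_mul_add_seven (2 * n + 1)
  rw [show 8 * (2 * n + 1) + 7 = 16 * n + 15 by ring, minChanges_two_mul_add_two,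
    maxChanges_two_mul_add_two] at h
  rw [P_sixteen_mul_add_three, P_eight_mul_add_three, P_eight_mul_add_six, P_eight_mul_add_seven,
    P_four_mul_add_two, P_two_mul_add_one]
  lia

theorem P_thirty_two_mul_add_three (n : ℕ) : P (32 * n + 3) = P (8 * n + 3) := by
  have h := P_sixteen_mul_add_three (2 * n)
  rw [← mul_assoc, minChanges_two_mul, maxChanges_two_mul] at h
  rw [P_eight_mul_add_three]
  lia

theorem P_thirty_two_mul_add_nineteen (n : ℕ) :
    P (32 * n + 19) = -P (16 * n + 3) + P (8 * n + 3) + 3 * P (8 * n + 2)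
      + 2 * P (4 * n + 3) - 3 * P (4 * n + 2) - P (2 * n + 1) := by
  have h := P_sixteen_mul_add_three (2 * n + 1)
  rw [show 16 * (2 * n + 1) + 3 = 32 * n + 19 by ring, minChanges_two_mul_add_one,
    maxChanges_two_mul_add_one] at h
  rw [P_sixteen_mul_add_three, P_eight_mul_add_two, P_eight_mul_add_three, P_four_mul_add_three,
    P_four_mul_add_two, P_two_mul_add_one]
  lia

theorem relations_P : Relations P :=
  ⟨P_four_mul_add_one, P_eight_mul_add_four, P_sixteen_mul, P_sixteen_mul_add_two,
    P_sixteen_mul_add_six, P_sixteen_mul_add_seven, P_sixteen_mul_add_eight,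
    P_sixteen_mul_add_ten, P_sixteen_mul_add_eleven, P_sixteen_mul_add_fourteen,
    P_sixteen_mul_add_fifteen, P_thirty_two_mul_add_three, P_thirty_two_mul_add_nineteen⟩

end Recurrences

section Kernel

open Submodule

theorem subseq_subseq (a : ℕ → ℤ) (p c q d : ℕ) :
    subseq (subseq a p c) q d = subseq a (p * q) (p * d + c) :=
  funext fun n => congrArg a (by ring)

theorem subseq_mem_span {S : Set (ℕ → ℤ)} {q r : ℕ} (hS : ∀ g ∈ S, subseq g q r ∈ span ℤ S)
    {f : ℕ → ℤ} (hf : f ∈ span ℤ S) : subseq f q r ∈ span ℤ S := by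
  have span_le_comap : span ℤ S ≤ (span ℤ S).comap (LinearMap.funLeft ℤ ℤ (q * · + r)) :=
    span_le.2 hS
  exact span_le_comap hf

variable {a : ℕ → ℤ}

theorem nine_subset_iff {S : Set (ℕ → ℤ)} :
    nine a ⊆ S ↔ subseq a 2 1 ∈ S ∧ subseq a 4 2 ∈ S ∧ subseq a 4 3 ∈ S ∧ subseq a 8 0 ∈ S ∧
      subseq a 8 2 ∈ S ∧ subseq a 8 3 ∈ S ∧ subseq a 8 6 ∈ S ∧ subseq a 8 7 ∈ S ∧
        subseq a 16 3 ∈ S := by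
  simp only [nine, Set.insert_subset_iff, Set.singleton_subset_iff]

theorem subseq_two_zero_mem_span_nine (h : Relations a) :
    ∀ g ∈ nine a, subseq g 2 0 ∈ span ℤ (nine a) := by
  obtain ⟨rel_4_1, -, rel_16_0, rel_16_2, rel_16_6, rel_16_7, -, -, -, -, -, rel_32_3, -⟩ := h
  obtain ⟨mem_2_1, mem_4_2, mem_4_3, mem_8_0, mem_8_2, mem_8_3, -, -, mem_16_3⟩ :=
    nine_subset_iff.1 (subset_span (R := ℤ) (s := nine a))
  have mem_16_6 : subseq a 16 6 ∈ span ℤ (nine a) := by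
    rw [show subseq a 16 6 = -subseq a 16 3 + subseq a 8 3 + (3 : ℤ) • subseq a 8 2
      + subseq a 4 3 - (2 : ℤ) • subseq a 4 2 - subseq a 2 1 from funext rel_16_6]
    apply_rules [sub_mem, add_mem, neg_mem, zsmul_mem]
  have mem_16_7 : subseq a 16 7 ∈ span ℤ (nine a) := by
    rw [show subseq a 16 7 = -subseq a 16 3 + subseq a 8 3 + (3 : ℤ) • subseq a 8 2
      + (2 : ℤ) • subseq a 4 3 - (3 : ℤ) • subseq a 4 2 - subseq a 2 1 from funext rel_16_7]
    apply_rules [sub_mem, add_mem, neg_mem, zsmul_mem]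
  refine (nine_subset_iff (S := {g | subseq g 2 0 ∈ span ℤ (nine a)})).2 ?_
  simp only [Set.mem_ofPred_eq, subseq_subseq, Nat.reduceMul, mul_zero, zero_add]
  rw [show subseq a 4 1 = subseq a 2 1 from funext rel_4_1,
    show subseq a 16 0 = subseq a 8 0 from funext rel_16_0,
    show subseq a 16 2 = subseq a 8 2 from funext rel_16_2,
    show subseq a 32 3 = subseq a 8 3 from funext rel_32_3]
  exact ⟨mem_2_1, mem_8_2, mem_8_3, mem_8_0, mem_8_2, mem_16_3, mem_16_6, mem_16_7, mem_8_3⟩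

theorem subseq_two_one_mem_span_nine (h : Relations a) :
    ∀ g ∈ nine a, subseq g 2 1 ∈ span ℤ (nine a) := by
  obtain ⟨-, -, -, -, -, -, rel_16_8, rel_16_10, rel_16_11, rel_16_14, rel_16_15, -, rel_32_19⟩ := h
  obtain ⟨mem_2_1, mem_4_2, mem_4_3, -, mem_8_2, mem_8_3, mem_8_6, mem_8_7, mem_16_3⟩ :=
    nine_subset_iff.1 (subset_span (R := ℤ) (s := nine a))
  have mem_16_8 : subseq a 16 8 ∈ span ℤ (nine a) := by
    rw [show subseq a 16 8 = subseq a 8 2 + subseq a 4 3 - subseq a 2 1 from funext rel_16_8]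
    apply_rules [sub_mem, add_mem, neg_mem, zsmul_mem]
  have mem_16_10 : subseq a 16 10 ∈ span ℤ (nine a) := by
    rw [show subseq a 16 10 = subseq a 8 2 + subseq a 4 3 - subseq a 2 1 from funext rel_16_10]
    apply_rules [sub_mem, add_mem, neg_mem, zsmul_mem]
  have mem_16_11 : subseq a 16 11 ∈ span ℤ (nine a) := by
    rw [show subseq a 16 11 = -subseq a 16 3 + (3 : ℤ) • subseq a 8 2 + subseq a 4 3
      - (2 : ℤ) • subseq a 2 1 from funext rel_16_11]
    apply_rules [sub_mem, add_mem, neg_mem, zsmul_mem]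
  have mem_16_14 : subseq a 16 14 ∈ span ℤ (nine a) := by
    rw [show subseq a 16 14 = subseq a 16 3 + subseq a 8 7 - subseq a 8 3 - subseq a 8 2
      - subseq a 4 3 + (3 : ℤ) • subseq a 4 2 - subseq a 2 1 from funext rel_16_14]
    apply_rules [sub_mem, add_mem, neg_mem, zsmul_mem]
  have mem_16_15 : subseq a 16 15 ∈ span ℤ (nine a) := by
    rw [show subseq a 16 15 = subseq a 16 3 + (2 : ℤ) • subseq a 8 7
      - (3 : ℤ) • subseq a 8 6 - (2 : ℤ) • subseq a 8 3 + (6 : ℤ) • subseq a 4 2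
      - (3 : ℤ) • subseq a 2 1 from funext rel_16_15]
    apply_rules [sub_mem, add_mem, neg_mem, zsmul_mem]
  have mem_32_19 : subseq a 32 19 ∈ span ℤ (nine a) := by
    rw [show subseq a 32 19 = -subseq a 16 3 + subseq a 8 3 + (3 : ℤ) • subseq a 8 2
      + (2 : ℤ) • subseq a 4 3 - (3 : ℤ) • subseq a 4 2 - subseq a 2 1 from funext rel_32_19]
    apply_rules [sub_mem, add_mem, neg_mem, zsmul_mem]
  refine (nine_subset_iff (S := {g | subseq g 2 1 ∈ span ℤ (nine a)})).2 ?_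
  simp only [Set.mem_ofPred_eq, subseq_subseq, Nat.reduceMul, Nat.reduceAdd, mul_one]
  exact ⟨mem_4_3, mem_8_6, mem_8_7, mem_16_8, mem_16_10, mem_16_11, mem_16_14, mem_16_15,
    mem_32_19⟩

theorem subseq_two_pow_succ (a : ℕ → ℤ) (e c : ℕ) :
    subseq a (2 ^ (e + 1)) c = subseq (subseq a (2 ^ e) (c % 2 ^ e)) 2 (c / 2 ^ e) := by
  rw [subseq_subseq, Nat.div_add_mod, pow_succ]

theorem subseq_two_pow_mem_span_nine (h : Relations a) (e c : ℕ) (hc : c < 2 ^ e)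
    (hne : ¬(c = 0 ∧ e ≤ 2)) : subseq a (2 ^ e) c ∈ span ℤ (nine a) := by
  induction e generalizing c with
  | zero => omega
  | succ e ih =>
    by_cases hsmall : c % 2 ^ e = 0 ∧ e ≤ 2
    · obtain ⟨mem_2_1, mem_4_2, mem_4_3, mem_8_0, -, mem_8_3, -⟩ :=
        nine_subset_iff.1 (subset_span (R := ℤ) (s := nine a))
      have mem_8_4 : subseq a 8 4 ∈ span ℤ (nine a) := by
        rw [show subseq a 8 4 = subseq a 8 3 + subseq a 4 3 - subseq a 4 2 from funext h.2.1]
        exact sub_mem (add_mem mem_8_3 mem_4_3) mem_4_2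
      obtain ⟨hmod, he⟩ := hsmall
      interval_cases e
      · obtain rfl : c = 1 := by omega
        exact mem_2_1
      · obtain rfl : c = 2 := by omega
        exact mem_4_2
      · obtain rfl | rfl : c = 0 ∨ c = 4 := by omega
        exacts [mem_8_0, mem_8_4]
    · have hmem := ih (c % 2 ^ e) (Nat.mod_lt _ (by positivity)) hsmall
      rw [subseq_two_pow_succ]
      have hdiv : c / 2 ^ e < 2 := Nat.div_lt_of_lt_mul (by rwa [pow_succ] at hc)
      obtain hd | hd := Nat.le_one_iff_eq_zero_or_eq_one.1 (Nat.lt_succ_iff.1 hdiv)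
      · exact hd ▸ subseq_mem_span (subseq_two_zero_mem_span_nine h) hmem
      · exact hd ▸ subseq_mem_span (subseq_two_one_mem_span_nine h) hmem

theorem nine_subset_kernel (a : ℕ → ℤ) : nine a ⊆ kernel 2 a :=
  nine_subset_iff.2 ⟨⟨1, 1, by norm_num, rfl⟩, ⟨2, 2, by norm_num, rfl⟩, ⟨2, 3, by norm_num, rfl⟩,
    ⟨3, 0, by norm_num, rfl⟩, ⟨3, 2, by norm_num, rfl⟩, ⟨3, 3, by norm_num, rfl⟩,
    ⟨3, 6, by norm_num, rfl⟩, ⟨3, 7, by norm_num, rfl⟩, ⟨4, 3, by norm_num, rfl⟩⟩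

theorem span_kernel_eq (h : Relations a) :
    span ℤ (kernel 2 a) = span ℤ (nine a ∪ {subseq a 1 0, subseq a 2 0, subseq a 4 0}) := by
  apply le_antisymm
  · rw [span_le]
    rintro b ⟨e, c, hc, rfl⟩
    by_cases hsmall : c = 0 ∧ e ≤ 2
    · obtain ⟨rfl, he⟩ := hsmall
      refine subset_span (.inr ?_)
      interval_cases e <;> simp
    · exact span_mono Set.subset_union_left (subseq_two_pow_mem_span_nine h e c hc hsmall)
  · refine span_mono (Set.union_subset (nine_subset_kernel a) ?_)
    rintro b (rfl | rfl | rfl)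
    exacts [⟨0, 0, by norm_num, rfl⟩, ⟨1, 0, by norm_num, rfl⟩, ⟨2, 0, by norm_num, rfl⟩]

theorem isRegular_of_relations (h : Relations a) : IsRegular 2 a := by
  rw [IsRegular, span_kernel_eq h]
  exact fg_span (Set.Finite.union (by simp [nine]) (by simp))

end Kernel

end TwoAbelian

/-- (1) The 2-abelian complexity `P` of the Thue–Morse word is 2-regular.
(2) It satisfies the 13 relations for all `n ≥ 0`.
(3) The 13 relations express every kernel subsequence `a (2^e n + c)`, apart from the three
subsequences `a n`, `a (2 n)`, `a (4 n)`, as a `ℤ`-combination of the nine fixed ones.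
(4) Hence the module generated by the 2-kernel of `P` is generated by these three subsequences and
the nine. -/
theorem theorem1 :
    TwoAbelian.IsRegular 2 TwoAbelian.P ∧
    TwoAbelian.Relations TwoAbelian.P ∧
    (∀ a : ℕ → ℤ, TwoAbelian.Relations a → ∀ e c : ℕ, c < 2 ^ e →
      ¬ (c = 0 ∧ e ≤ 2) →
        TwoAbelian.subseq a (2 ^ e) c ∈ Submodule.span ℤ (TwoAbelian.nine a)) ∧
    Submodule.span ℤ (TwoAbelian.kernel 2 TwoAbelian.P) =
      Submodule.span ℤ (TwoAbelian.nine TwoAbelian.P ∪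
        {TwoAbelian.subseq TwoAbelian.P 1 0, TwoAbelian.subseq TwoAbelian.P 2 0,
          TwoAbelian.subseq TwoAbelian.P 4 0}) :=
  ⟨TwoAbelian.isRegular_of_relations TwoAbelian.relations_P, TwoAbelian.relations_P,
    fun _ => TwoAbelian.subseq_two_pow_mem_span_nine,
    TwoAbelian.span_kernel_eq TwoAbelian.relations_P⟩
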